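/- **Setting.** Let $\mathbf M$ be a globally hyperbolic spacetime (a smooth time-oriented Lorentzian manifold without closed causal curves and with compact causal diamonds $J^+(p)\cap J^-(q)$). Let $\mathfrak A$ be a von Neumann QFT on $\mathbf M$: a map assigning to every nonempty open causally convex $\mathbf R\subseteq\mathbf M$ a non-abelian von Neumann algebra $\mathfrak A(\mathbf R)\subseteq\mathcal B(\mathcal H)$, such that $\mathfrak A(\mathbf R)\subseteq\mathfrak A(\mathbf S)$ if $\mathbf R\subseteq\mathbf S$, and such that $\mathfrak A(\mathbf R)$ and $\mathfrak A(\mathbf S)$ commute if $\mathbf R,\mathbf S$ are spacelike separated. Assume all $\mathfrak A(\mathbf R)$ are $\sigma$-finite. For any other $X\subseteq\mathbf M$ let $\mathfrak A(X)$ be the von Neumann algebra generated by the $\mathfrak A(\mathbf R)$ with $\mathbf R\subseteq X$. Write $X^\perp$ for the set of points that are spacelike separated from $X$, $X_{\rm in}=\mathbf M\setminus J^+(X)$ and $X_{\rm out}=\mathbf M\setminus J^-(X)$. A channel is a unital completely positive linear map $\Phi:\mathfrak A(\mathbf M)\to\mathfrak A(\mathbf M)$; $\mathrm{Loc}(X)$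 is the set of channels that are the identity on $\mathfrak A(X^\perp)$. A channel $\Phi\in\mathrm{Loc}(\mathbf K)$ is causal if $$\rho\big(\Phi_{\mathbf S}(\Phi(O))-\Phi(O)\big)=0$$ for all states $\rho$ of $\mathfrak A(\mathbf M)$, all spacelike separated compact $\mathbf S\subseteq\mathbf K_{\rm in}$ and $\mathbf R\subseteq\mathbf K_{\rm out}$, all $\Phi_{\mathbf S}\in\mathrm{Loc}(\mathbf S)$ and all $O\in\mathfrak A(\mathbf R)$; otherwise it is acausal. Let $\sigma\text{-}\mathrm{CB}$ be the space of $\sigma$-weakly continuous completely bounded linear maps $\mathfrak A(\mathbf M)\to\mathfrak A(\mathbf M)$, and let $\mathrm{nLoc}(\mathbf K)$ and $\mathrm{nCau}(\mathbf K)$ be the sets of those elements of $\sigma\text{-}\mathrm{CB}$ that are channels local to $\mathbf K$, respectively causal channels local to $\mathbf K$. The weak* topology on $\sigma\text{-}\mathrm{CB}$ is the coarsest one for which the pairings with all elements of the operator space projective tensor product $\mathfrak A(\mathbf M)\,\widehat\otimes\,\mathfrak A(\mathbf M)_*$, determined by $\langle O\otimes\omega,\Psi\rangle=\omega(\Psi(O))$,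 are continuous. **Theorem.** Let $\mathbf K\subseteq\mathbf M$ be compact and suppose that some $\Phi\in\mathrm{nLoc}(\mathbf K)$ is acausal. 1. $\mathrm{nCau}(\mathbf K)$ is nowhere dense in $\mathrm{nLoc}(\mathbf K)$ with respect to the CB-norm topology. 2. Suppose moreover that for every compact $\mathbf S$ with $\mathbf S^\perp\neq\emptyset$ the algebra $\mathfrak A(\mathbf S^\perp)$ is its own bicommutant relative to $\mathfrak A(\mathbf M)$, i.e. every element of $\mathfrak A(\mathbf M)$ that commutes with $\mathfrak A(\mathbf S^\perp)'\cap\mathfrak A(\mathbf M)$ lies in $\mathfrak A(\mathbf S^\perp)$ (this holds whenever $\mathfrak A(\mathbf S^\perp)'\subseteq\mathfrak A(\mathbf M)$ for all such $\mathbf S$, in particular if $\mathfrak A(\mathbf M)=\mathcal B(\mathcal H)$). Then $\mathrm{nCau}(\mathbf K)$ is nowhere dense in $\mathrm{nLoc}(\mathbf K)$ with respect to the weak* topology on $\sigma\text{-}\mathrm{CB}$. -/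

import Mathlib

open scoped Manifold ContDiff Topology TensorProduct InnerProductSpace

noncomputable section

/-! ### Spacetimes and their causal structure -/

/-- A smooth time-oriented Lorentzian metric (signature `- + ... +`) on the `d`-dimensional
manifold `M`. The time orientation is given by a smooth timelike vector field `timeField`; the
signature condition says that this field is timelike and that the metric is positive definite on
its orthogonal complement. -/
structure LorentzianSpacetime (d : ℕ) (M : Type*) [TopologicalSpace M]
    [ChartedSpace (EuclideanSpace ℝ (Fin d)) M] [IsManifold (𝓡 d) ∞ M] where
  /-- the metric tensor -/
  metric (x : M) : TangentSpace (𝓡 d) x →L[ℝ] TangentSpace (𝓡 d) x →L[ℝ] ℝ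
  symm (x : M) (v w : TangentSpace (𝓡 d) x) : metric x v w = metric x w v
  smooth_metric :
    ContMDiff (𝓡 d) ((𝓡 d).prod 𝓘(ℝ, EuclideanSpace ℝ (Fin d) →L[ℝ]
        EuclideanSpace ℝ (Fin d) →L[ℝ] ℝ)) ∞
      (fun x => Bundle.TotalSpace.mk' (EuclideanSpace ℝ (Fin d) →L[ℝ]
        EuclideanSpace ℝ (Fin d) →L[ℝ] ℝ)
        (E := fun x : M => TangentSpace (𝓡 d) x →L[ℝ] TangentSpace (𝓡 d) x →L[ℝ] ℝ)
        x (metric x))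
  /-- the future-pointing timelike vector field -/
  timeField (x : M) : TangentSpace (𝓡 d) x
  smooth_timeField :
    ContMDiff (𝓡 d) (𝓡 d).tangent ∞ (fun x => (⟨x, timeField x⟩ : TangentBundle (𝓡 d) M))
  timelike (x : M) : metric x (timeField x) (timeField x) < 0
  pos_on_orthogonal (x : M) (v : TangentSpace (𝓡 d) x) :
    v ≠ 0 → metric x v (timeField x) = 0 → 0 < metric x v v

namespace LorentzianSpacetime

variable {d : ℕ} {M : Type*} [TopologicalSpace M]
  [ChartedSpace (EuclideanSpace ℝ (Fin d)) M] [IsManifold (𝓡 d) ∞ M]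

/-- `v` is a (nonzero) future-directed causal vector. -/
def FutureCausal (L : LorentzianSpacetime d M) {x : M} (v : TangentSpace (𝓡 d) x) : Prop :=
  L.metric x v v ≤ 0 ∧ L.metric x v (L.timeField x) < 0

/-- There is a smooth future-directed causal curve from `p` to `q`. -/
def CausalCurve (L : LorentzianSpacetime d M) (p q : M) : Prop :=
  ∃ γ : ℝ → M, ContMDiff 𝓘(ℝ, ℝ) (𝓡 d) ∞ γ ∧ γ 0 = p ∧ γ 1 = q ∧
    ∀ t ∈ Set.Icc (0 : ℝ) 1,
      L.FutureCausal (x := γ t) (mfderiv 𝓘(ℝ, ℝ) (𝓡 d) γ t (1 : ℝ))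

/-- `p ≤ q`: either `p = q` or there is a piecewise smooth future-directed causal curve from
`p` to `q`. -/
def CausalLE (L : LorentzianSpacetime d M) : M → M → Prop :=
  Relation.ReflTransGen L.CausalCurve

/-- The causal future `J⁺(X)`. -/
def JPlus (L : LorentzianSpacetime d M) (X : Set M) : Set M := {q | ∃ p ∈ X, L.CausalLE p q}

/-- The causal past `J⁻(X)`. -/
def JMinus (L : LorentzianSpacetime d M) (X : Set M) : Set M := {q | ∃ p ∈ X, L.CausalLE q p}

/-- Global hyperbolicity: no closed causal curves, and compact causal diamonds. -/
def GloballyHyperbolic (L : LorentzianSpacetime d M) : Prop :=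
  (∀ p q, L.CausalLE p q → L.CausalLE q p → p = q) ∧
    ∀ p q, IsCompact (L.JPlus {p} ∩ L.JMinus {q})

/-- `X` and `Y` are spacelike separated: no point of one is causally related to a point of the
other. -/
def SpacelikeSeparated (L : LorentzianSpacetime d M) (X Y : Set M) : Prop :=
  ∀ x ∈ X, ∀ y ∈ Y, ¬ L.CausalLE x y ∧ ¬ L.CausalLE y x

/-- The spacelike complement `X^⊥`: all points spacelike separated from `X`. -/
def spacelikeCompl (L : LorentzianSpacetime d M) (X : Set M) : Set M :=
  {y | L.SpacelikeSeparated X {y}}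

/-- The in-region `M \ J⁺(X)`. -/
def inRegion (L : LorentzianSpacetime d M) (X : Set M) : Set M := (L.JPlus X)ᶜ

/-- The out-region `M \ J⁻(X)`. -/
def outRegion (L : LorentzianSpacetime d M) (X : Set M) : Set M := (L.JMinus X)ᶜ

/-- Every causal curve between points of `X` stays in `X`. -/
def CausallyConvex (L : LorentzianSpacetime d M) (X : Set M) : Prop :=
  ∀ p ∈ X, ∀ r ∈ X, ∀ q, L.CausalLE p q → L.CausalLE q r → q ∈ X

/-- A region: a nonempty open causally convex subset of spacetime. -/
structure Region (L : LorentzianSpacetime d M) where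
  carrier : Set M
  isOpen : IsOpen carrier
  nonempty : carrier.Nonempty
  causallyConvex : L.CausallyConvex carrier

/-- The whole spacetime as a region. -/
def wholeRegion [Nonempty M] (L : LorentzianSpacetime d M) : L.Region where
  carrier := Set.univ
  isOpen := isOpen_univ
  nonempty := Set.univ_nonempty
  causallyConvex := fun _ _ _ _ _ _ _ => Set.mem_univ _

end LorentzianSpacetime

/-! ### Von Neumann algebras, completely bounded maps, channels -/

namespace VonNeumannAlgebra

variable {H : Type*} [NormedAddCommGroup H] [InnerProductSpace ℂ H] [CompleteSpace H]

/-- The von Neumann algebra as a type. -/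
abbrev Elt (A : VonNeumannAlgebra H) : Type _ := A.toStarSubalgebra

/-- `A` is σ-finite: every family of pairwise orthogonal nonzero projections in `A` is
countable. -/
def SigmaFinite (A : VonNeumannAlgebra H) : Prop :=
  ∀ P : Set (H →L[ℂ] H), (∀ p ∈ P, p ∈ A ∧ IsStarProjection p ∧ p ≠ 0) →
    (P.Pairwise fun p q => p * q = 0) → P.Countable

variable (A : VonNeumannAlgebra H)

/-- A matrix over `A`, seen in the C⋆-algebra `M_n(B(H))`, of which `M_n(A)` is a
C⋆-subalgebra; norm and order of `M_n(A)` are those of `M_n(B(H))`. -/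
def toCStarMatrix {n : ℕ} (x : Matrix (Fin n) (Fin n) A.Elt) :
    CStarMatrix (Fin n) (Fin n) (H →L[ℂ] H) :=
  CStarMatrix.ofMatrix (x.map (fun a => (a : H →L[ℂ] H)))

/-- The operator norm on `M_n(A)`. -/
def matNorm {n : ℕ} (x : Matrix (Fin n) (Fin n) A.Elt) : ℝ := ‖A.toCStarMatrix x‖

/-- The σ-weak (ultraweak) topology on `A`: the coarsest topology for which all the functionals
`a ↦ ∑ ⟨ξ_n, a η_n⟩` with `∑ ‖ξ_n‖² < ∞` and `∑ ‖η_n‖² < ∞` are continuous. -/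
@[reducible] def sigmaWeak : TopologicalSpace A.Elt :=
  ⨅ p : {p : (ℕ → H) × (ℕ → H) //
      (Summable fun n => ‖p.1 n‖ ^ 2) ∧ Summable fun n => ‖p.2 n‖ ^ 2},
    TopologicalSpace.induced
      (fun a : A.Elt => ∑' n, ⟪p.1.1 n, (a : H →L[ℂ] H) (p.1.2 n)⟫_ℂ) inferInstance

/-- The predual `A_*`: the normal (σ-weakly continuous) linear functionals on `A`. -/
def Predual : Submodule ℂ (Module.Dual ℂ A.Elt) where
  carrier := {φ | Continuous[A.sigmaWeak, inferInstance] φ}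
  add_mem' {φ ψ} hφ hψ := by
    let _ := A.sigmaWeak
    exact Continuous.add (f := φ) (g := ψ) hφ hψ
  zero_mem' := by
    let _ := A.sigmaWeak
    exact continuous_const
  smul_mem' c φ hφ := by
    let _ := A.sigmaWeak
    exact Continuous.const_smul (g := φ) hφ c

/-- `Ψ : A → A` is continuous from the σ-weak to the σ-weak topology. -/
def SigmaWeaklyContinuous (Ψ : A.Elt →ₗ[ℂ] A.Elt) : Prop :=
  Continuous[A.sigmaWeak, A.sigmaWeak] Ψ

/-- `‖Ψⁿ(x)‖ ≤ c ‖x‖` for all `n` and all `x ∈ M_n(A)`, where `Ψⁿ` is `Ψ` applied entrywise. -/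
def CBBound (Ψ : A.Elt →ₗ[ℂ] A.Elt) (c : ℝ) : Prop :=
  0 ≤ c ∧ ∀ (n : ℕ) (x : Matrix (Fin n) (Fin n) A.Elt), A.matNorm (x.map Ψ) ≤ c * A.matNorm x

/-- `Ψ` is completely bounded. -/
def CompletelyBounded (Ψ : A.Elt →ₗ[ℂ] A.Elt) : Prop := ∃ c, A.CBBound Ψ c

/-- The completely bounded norm `sup_n ‖Ψⁿ‖`, as the least bound. -/
def cbNorm (Ψ : A.Elt →ₗ[ℂ] A.Elt) : ℝ := sInf {c | A.CBBound Ψ c}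

variable {A}

lemma toCStarMatrix_add {n : ℕ} (x y : Matrix (Fin n) (Fin n) A.Elt) :
    A.toCStarMatrix (x + y) = A.toCStarMatrix x + A.toCStarMatrix y := by
  ext i j; rfl

lemma toCStarMatrix_smul {n : ℕ} (c : ℂ) (x : Matrix (Fin n) (Fin n) A.Elt) :
    A.toCStarMatrix (c • x) = c • A.toCStarMatrix x := by
  ext i j; rfl

lemma matNorm_nonneg {n : ℕ} (x : Matrix (Fin n) (Fin n) A.Elt) : 0 ≤ A.matNorm x :=
  norm_nonneg _

lemma CBBound.add {Ψ Θ : A.Elt →ₗ[ℂ] A.Elt} {c e : ℝ} (h : A.CBBound Ψ c) (k : A.CBBound Θ e) :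
    A.CBBound (Ψ + Θ) (c + e) := by
  refine ⟨add_nonneg h.1 k.1, fun n x => ?_⟩
  have : x.map (Ψ + Θ) = x.map Ψ + x.map Θ := by ext i j; rfl
  rw [this, matNorm, toCStarMatrix_add, add_mul]
  exact (norm_add_le _ _).trans (add_le_add (h.2 n x) (k.2 n x))

lemma CBBound.smul {Ψ : A.Elt →ₗ[ℂ] A.Elt} {c : ℝ} (h : A.CBBound Ψ c) (z : ℂ) :
    A.CBBound (z • Ψ) (‖z‖ * c) := by
  refine ⟨mul_nonneg (norm_nonneg _) h.1, fun n x => ?_⟩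
  have : x.map (z • Ψ) = z • x.map Ψ := by ext i j; rfl
  rw [this, matNorm, toCStarMatrix_smul, norm_smul, mul_assoc]
  exact mul_le_mul_of_nonneg_left (h.2 n x) (norm_nonneg _)

lemma CBBound.zero : A.CBBound 0 0 := by
  refine ⟨le_rfl, fun n x => ?_⟩
  have : A.toCStarMatrix (x.map (0 : A.Elt →ₗ[ℂ] A.Elt)) = 0 := by ext i j; rfl
  simp [matNorm, this]

lemma cbNorm_nonneg (Ψ : A.Elt →ₗ[ℂ] A.Elt) : 0 ≤ A.cbNorm Ψ :=
  Real.sInf_nonneg fun _ h => h.1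

lemma cbNorm_le {Ψ : A.Elt →ₗ[ℂ] A.Elt} {c : ℝ} (h : A.CBBound Ψ c) : A.cbNorm Ψ ≤ c :=
  csInf_le ⟨0, fun _ h => h.1⟩ h

lemma cbBound_cbNorm {Ψ : A.Elt →ₗ[ℂ] A.Elt} (h : A.CompletelyBounded Ψ) :
    A.CBBound Ψ (A.cbNorm Ψ) := by
  refine ⟨cbNorm_nonneg Ψ, fun n x => ?_⟩
  refine le_of_forall_pos_le_add fun ε hε => ?_
  have hx := matNorm_nonneg x
  have hpos : 0 < ε / (A.matNorm x + 1) := by positivity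
  obtain ⟨c, hc, hlt⟩ := exists_lt_of_csInf_lt (s := {c | A.CBBound Ψ c}) h
    (lt_add_of_pos_right (A.cbNorm Ψ) hpos)
  calc A.matNorm (x.map Ψ) ≤ c * A.matNorm x := hc.2 n x
    _ ≤ (A.cbNorm Ψ + ε / (A.matNorm x + 1)) * A.matNorm x :=
        mul_le_mul_of_nonneg_right hlt.le hx
    _ = A.cbNorm Ψ * A.matNorm x + ε * (A.matNorm x / (A.matNorm x + 1)) := by ring
    _ ≤ A.cbNorm Ψ * A.matNorm x + ε := by
        have : A.matNorm x / (A.matNorm x + 1) ≤ 1 := by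
          rw [div_le_one (by positivity)]; linarith
        nlinarith

variable (A)

/-- `σ-CB(A)`: the σ-weakly continuous completely bounded maps `A → A`. -/
def SigmaCB : Submodule ℂ (A.Elt →ₗ[ℂ] A.Elt) where
  carrier := {Ψ | A.CompletelyBounded Ψ ∧ A.SigmaWeaklyContinuous Ψ}
  add_mem' {Ψ Θ} h k := by
    obtain ⟨c, hc⟩ := h.1
    obtain ⟨e, he⟩ := k.1
    refine ⟨⟨c + e, hc.add he⟩, continuous_iInf_rng.2 fun p => continuous_induced_rng.2 ?_⟩
    let _ := A.sigmaWeak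
    have h1 := continuous_induced_rng.1 (continuous_iInf_rng.1 h.2 p)
    have h2 := continuous_induced_rng.1 (continuous_iInf_rng.1 k.2 p)
    refine (h1.add h2).congr fun a => ?_
    have hs : ∀ b : A.Elt, Summable fun n => ⟪p.1.1 n, (b : H →L[ℂ] H) (p.1.2 n)⟫_ℂ := by
      intro b
      refine Summable.of_norm_bounded
        (g := fun n => ‖(b : H →L[ℂ] H)‖ * (‖p.1.1 n‖ ^ 2 + ‖p.1.2 n‖ ^ 2))
        ((p.2.1.add p.2.2).mul_left _) fun n => ?_
      have e1 := norm_inner_le_norm (𝕜 := ℂ) (p.1.1 n) ((b : H →L[ℂ] H) (p.1.2 n))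
      have e2 := (b : H →L[ℂ] H).le_opNorm (p.1.2 n)
      have e3 : ‖p.1.1 n‖ * ‖p.1.2 n‖ ≤ ‖p.1.1 n‖ ^ 2 + ‖p.1.2 n‖ ^ 2 := by
        nlinarith [sq_nonneg (‖p.1.1 n‖ - ‖p.1.2 n‖), sq_nonneg (‖p.1.1 n‖ + ‖p.1.2 n‖)]
      calc _ ≤ ‖p.1.1 n‖ * (‖(b : H →L[ℂ] H)‖ * ‖p.1.2 n‖) :=
            e1.trans (mul_le_mul_of_nonneg_left e2 (norm_nonneg _))
        _ = ‖(b : H →L[ℂ] H)‖ * (‖p.1.1 n‖ * ‖p.1.2 n‖) := by ring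
        _ ≤ _ := mul_le_mul_of_nonneg_left e3 (norm_nonneg _)
    simp only [Pi.add_apply, Function.comp_apply]
    rw [← (hs _).tsum_add (hs _)]
    refine tsum_congr fun n => ?_
    simp
  zero_mem' := by
    let _ := A.sigmaWeak
    exact ⟨⟨0, CBBound.zero⟩, continuous_const⟩
  smul_mem' z Ψ h := by
    obtain ⟨c, hc⟩ := h.1
    refine ⟨⟨_, hc.smul z⟩, continuous_iInf_rng.2 fun p => continuous_induced_rng.2 ?_⟩
    let _ := A.sigmaWeak
    have h1 := continuous_induced_rng.1 (continuous_iInf_rng.1 h.2 p)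
    refine (h1.const_smul z).congr fun a => ?_
    simp only [Pi.smul_apply, Function.comp_apply]
    rw [smul_eq_mul, ← tsum_mul_left]
    refine tsum_congr fun n => ?_
    simp

/-- `σ-CB(A)` with the CB-norm. -/
instance : NormedAddCommGroup A.SigmaCB :=
  AddGroupNorm.toNormedAddCommGroup
    { toFun := fun Ψ => A.cbNorm (Ψ : A.Elt →ₗ[ℂ] A.Elt)
      map_zero' := le_antisymm (cbNorm_le CBBound.zero) (cbNorm_nonneg _)
      add_le' := fun Ψ Θ =>
        cbNorm_le ((cbBound_cbNorm Ψ.2.1).add (cbBound_cbNorm Θ.2.1))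
      neg' := by
        have key : ∀ Ψ : A.SigmaCB, A.cbNorm (-Ψ : A.SigmaCB).1 ≤ A.cbNorm Ψ.1 := by
          intro Ψ
          have := (cbBound_cbNorm Ψ.2.1).smul (-1)
          rw [norm_neg, norm_one, one_mul, neg_one_smul] at this
          exact cbNorm_le this
        intro Ψ
        refine le_antisymm (key Ψ) ?_
        simpa using key (-Ψ)
      eq_zero_of_map_eq_zero' := by
        intro Ψ h
        have hb := cbBound_cbNorm Ψ.2.1
        rw [show A.cbNorm Ψ.1 = 0 from h] at hb
        ext1
        refine LinearMap.ext fun a => Subtype.ext ?_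
        have h1 := hb.2 1 (Matrix.of fun _ _ => a)
        rw [zero_mul] at h1
        have h2 : A.toCStarMatrix ((Matrix.of fun _ _ : Fin 1 => a).map Ψ.1) = 0 :=
          norm_le_zero_iff.1 h1
        exact congrFun (congrFun h2 0) 0 }

/-! #### The predual of `σ-CB(A)` and its weak⋆ topology -/

/-- The operator space norm on `M_q(A_*)`: the completely bounded norm of the associated map
`A → M_q(ℂ)`, `a ↦ (w_ij(a))`. -/
def predualMatNorm {q : ℕ} (w : Matrix (Fin q) (Fin q) A.Predual) : ℝ :=
  sInf {c | 0 ≤ c ∧ ∀ (n : ℕ) (x : Matrix (Fin n) (Fin n) A.Elt),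
    ‖Matrix.toEuclideanCLM (𝕜 := ℂ)
      (Matrix.of fun r s : Fin n × Fin q => (w r.2 s.2).1 (x r.1 s.1))‖ ≤ c * A.matNorm x}

/-- The operator space projective norm on `A ⊗ A_*`: the infimum of `‖a‖ ‖b‖ ‖v‖ ‖w‖` over all
`p`, `q` and all decompositions `u = a (v ⊗ w) b` with a scalar row `a ∈ M_{1,pq}`, a scalar column
`b ∈ M_{pq,1}`, `v ∈ M_p(A)` and `w ∈ M_q(A_*)`. -/
def projNorm (u : A.Elt ⊗[ℂ] A.Predual) : ℝ :=
  sInf {t | ∃ (p q : ℕ) (a b : EuclideanSpace ℂ (Fin p × Fin q))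
    (v : Matrix (Fin p) (Fin p) A.Elt) (w : Matrix (Fin q) (Fin q) A.Predual),
    u = ∑ r : Fin p × Fin q, ∑ s : Fin p × Fin q,
      (a r * b s) • (v r.1 s.1 ⊗ₜ[ℂ] w r.2 s.2) ∧
    t = ‖a‖ * ‖b‖ * A.matNorm v * A.predualMatNorm w}

/-- The duality pairing `⟨a ⊗ ω, Ψ⟩ = ω(Ψ(a))`. -/
def pairing (Ψ : A.Elt →ₗ[ℂ] A.Elt) : A.Elt ⊗[ℂ] A.Predual →ₗ[ℂ] ℂ :=
  TensorProduct.lift ((Module.Dual.eval ℂ A.Elt ∘ₗ Ψ).compl₂ A.Predual.subtype)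

/-- The elements of the predual of `σ-CB(A)`, as functionals on `σ-CB(A)`: each is given by an
element of the completion of `A ⊗ A_*` in the operator space projective norm, i.e. by a Cauchy
sequence in that norm. (Elements of the completion that agree on `σ-CB(A)` are thereby identified,
which is the quotient by the pre-annihilator.) -/
def IsPredualFunctional (f : A.SigmaCB → ℂ) : Prop :=
  ∃ u : ℕ → A.Elt ⊗[ℂ] A.Predual,
    (∀ ε > 0, ∃ N, ∀ m ≥ N, ∀ n ≥ N, A.projNorm (u m - u n) < ε) ∧
    ∀ Ψ : A.SigmaCB, Filter.Tendsto (fun n => A.pairing Ψ.1 (u n)) Filter.atTop (𝓝 (f Ψ))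

/-- The weak⋆ topology on `σ-CB(A)`: the coarsest topology making all elements of the predual
continuous. -/
@[reducible] def weakStarTopology : TopologicalSpace A.SigmaCB :=
  ⨅ f : {f : A.SigmaCB → ℂ // A.IsPredualFunctional f},
    TopologicalSpace.induced f.1 inferInstance

/-! #### States and channels -/

/-- `ρ` is a state on `A` (not necessarily normal). -/
def IsState (ρ : A.Elt →ₗ[ℂ] ℂ) : Prop :=
  (∀ a : A.Elt, ∃ r : ℝ, 0 ≤ r ∧ ρ (star a * a) = r) ∧ ρ 1 = 1

/-- `Φ ∈ UCP(A)`: `Φ` is a quantum channel, i.e. unital and completely positive (not necessarily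
normal). -/
def IsChannel (Φ : A.Elt →ₗ[ℂ] A.Elt) : Prop :=
  Φ 1 = 1 ∧ ∀ (n : ℕ) (x : Matrix (Fin n) (Fin n) A.Elt),
    0 ≤ A.toCStarMatrix x → 0 ≤ A.toCStarMatrix (x.map Φ)

end VonNeumannAlgebra

/-! ### Quantum field theories, local and causal channels -/

/-- A (von Neumann) QFT on the spacetime `L`: an isotonous net of non-abelian von Neumann algebras
on `H`, such that algebras of spacelike separated regions commute. -/
structure QFT {d : ℕ} {M : Type*} [TopologicalSpace M]
    [ChartedSpace (EuclideanSpace ℝ (Fin d)) M] [IsManifold (𝓡 d) ∞ M]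
    (L : LorentzianSpacetime d M)
    (H : Type*) [NormedAddCommGroup H] [InnerProductSpace ℂ H] [CompleteSpace H] where
  /-- the algebra of a region -/
  alg : L.Region → VonNeumannAlgebra H
  nonabelian (R : L.Region) : ∃ a ∈ alg R, ∃ b ∈ alg R, a * b ≠ b * a
  isotony (R S : L.Region) : R.carrier ⊆ S.carrier → alg R ≤ alg S
  commute (R S : L.Region) : L.SpacelikeSeparated R.carrier S.carrier →
    ∀ a ∈ alg R, ∀ b ∈ alg S, a * b = b * a

namespace QFT

variable {d : ℕ} {M : Type*} [TopologicalSpace M]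
  [ChartedSpace (EuclideanSpace ℝ (Fin d)) M] [IsManifold (𝓡 d) ∞ M]
  {L : LorentzianSpacetime d M}
  {H : Type*} [NormedAddCommGroup H] [InnerProductSpace ℂ H] [CompleteSpace H]

/-- Every local algebra is σ-finite. -/
def SigmaFinite (𝔄 : QFT L H) : Prop := ∀ R : L.Region, (𝔄.alg R).SigmaFinite

/-- The algebra `𝔄(X)` of an arbitrary subset `X` of spacetime: the von Neumann algebra (double
commutant) generated by the algebras of all regions contained in `X`. If `X` is a region this is
the algebra of that region, see `algOn_region`; if `X` contains no region, it is `ℂ 1`. -/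
def algOn (𝔄 : QFT L H) (X : Set M) : Set (H →L[ℂ] H) :=
  Set.centralizer (Set.centralizer
    {a | ∃ R : L.Region, R.carrier ⊆ X ∧ a ∈ 𝔄.alg R})

lemma algOn_region (𝔄 : QFT L H) (R : L.Region) :
    𝔄.algOn R.carrier = (𝔄.alg R : Set (H →L[ℂ] H)) := by
  have : {a | ∃ S : L.Region, S.carrier ⊆ R.carrier ∧ a ∈ 𝔄.alg S}
      = (𝔄.alg R : Set (H →L[ℂ] H)) := by
    ext a
    exact ⟨fun ⟨S, hS, ha⟩ => 𝔄.isotony S R hS ha, fun ha => ⟨R, subset_rfl, ha⟩⟩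
  rw [algOn, this, VonNeumannAlgebra.centralizer_centralizer]

variable [Nonempty M]

/-- The global algebra `𝔄(M)`. -/
abbrev globalAlg (𝔄 : QFT L H) : VonNeumannAlgebra H := 𝔄.alg L.wholeRegion

/-- `Loc(X)`: the channels of `𝔄(M)` that act trivially on `𝔄(X^⊥)`. -/
def Loc (𝔄 : QFT L H) (X : Set M) : Set (𝔄.globalAlg.Elt →ₗ[ℂ] 𝔄.globalAlg.Elt) :=
  {Φ | 𝔄.globalAlg.IsChannel Φ ∧
    ∀ a : 𝔄.globalAlg.Elt, (a : H →L[ℂ] H) ∈ 𝔄.algOn (L.spacelikeCompl X) → Φ a = a}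

/-- `Cau(K)`: the channels `Φ` local to `K` such that `ρ(Φ_S(Φ(O)) - Φ(O)) = 0` for all states `ρ`,
all spacelike separated compact `S ⊆ K_in` and `R ⊆ K_out`, all channels `Φ_S` local to `S` and all
`O` in the algebra of `R`. -/
def Cau (𝔄 : QFT L H) (K : Set M) : Set (𝔄.globalAlg.Elt →ₗ[ℂ] 𝔄.globalAlg.Elt) :=
  {Φ | Φ ∈ 𝔄.Loc K ∧
    ∀ ρ : 𝔄.globalAlg.Elt →ₗ[ℂ] ℂ, 𝔄.globalAlg.IsState ρ →
    ∀ S R : Set M, IsCompact S → IsCompact R → S ⊆ L.inRegion K → R ⊆ L.outRegion K →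
      L.SpacelikeSeparated S R →
    ∀ ΦS ∈ 𝔄.Loc S,
    ∀ O : 𝔄.globalAlg.Elt, (O : H →L[ℂ] H) ∈ 𝔄.algOn R → ρ (ΦS (Φ O) - Φ O) = 0}

/-- `nLoc(K)`: the normal channels local to `K`, as a subset of `σ-CB(𝔄(M))`. -/
def nLoc (𝔄 : QFT L H) (K : Set M) : Set 𝔄.globalAlg.SigmaCB := {Φ | Φ.1 ∈ 𝔄.Loc K}

/-- `nCau(K)`: the causal normal channels, as a subset of `σ-CB(𝔄(M))`. -/
def nCau (𝔄 : QFT L H) (K : Set M) : Set 𝔄.globalAlg.SigmaCB := {Φ | Φ.1 ∈ 𝔄.Cau K}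

/-- For every compact `S` with nonempty spacelike complement, `𝔄(S^⊥)` is its own bicommutant
relative to `𝔄(M)`. This holds e.g. if `𝔄(M) = B(H)`, and more generally if the unitaries of
the commutant `𝔄(S^⊥)'` belong to `𝔄(M)`, so that they implement channels of `𝔄(M)`. -/
def RelativeBicommutant (𝔄 : QFT L H) : Prop :=
  ∀ S : Set M, IsCompact S → (L.spacelikeCompl S).Nonempty →
    ∀ x ∈ 𝔄.globalAlg,
      (∀ y ∈ 𝔄.globalAlg, y ∈ Set.centralizer (𝔄.algOn (L.spacelikeCompl S)) → x * y = y * x) →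
      x ∈ 𝔄.algOn (L.spacelikeCompl S)

end QFT

end

noncomputable section

/-! States separate points, so causality of `Φ` is the family of equations `ΦS (Φ O) = Φ O`
(`QFT.mem_Cau_iff`), each linear in `Φ`. The local channels form a convex set. If `Ψ` is local and
acausal and `Φ` is causal, then `Φ + t (Ψ - Φ)` is local for `0 < t ≤ 1` and cannot be causal: an
equation that holds for `Φ` and for the mixture holds for `Ψ` (`QFT.Cau_segment`). As `t → 0` the
mixture tends to `Φ` in both topologies, so the causal channels have empty interior, and it remains
to see that they are relatively closed.

In the CB-norm this holds because every channel `ΦS` is bounded. In the weak⋆ topology it is less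
clear, as `ΦS` need not be normal. The bicommutant hypothesis eliminates `ΦS`: unitaries in the
relative commutant of `𝔄(S^⊥)` implement channels local to `S`, so a common fixed point of `Loc S`
commutes with that commutant; conversely, an element that does so lies in `𝔄(S^⊥)` and is fixed
(`QFT.mem_Cau_iff_commute`). Commutation of `Φ O` with a fixed operator is tested on matrix
coefficients, which are weak⋆ continuous. -/

/-- A closed relative subset of `N` from each of whose points one can leave it inside `N` along a
path is nowhere dense in `N`. -/
lemma isNowhereDense_preimage_val_of_path {V : Type*} [TopologicalSpace V] {N C : Set V}
    (hC : IsClosed {x : N | (x : V) ∈ C}) (γ : V → ℝ → V)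
    (hγ : ∀ x ∈ N, x ∈ C → ∀ t ∈ Set.Ioc (0 : ℝ) 1, γ x t ∈ N ∧ γ x t ∉ C)
    (hlim : ∀ x ∈ N, x ∈ C → Filter.Tendsto (γ x) (𝓝[>] 0) (𝓝 x)) :
    IsNowhereDense {x : N | (x : V) ∈ C} := by
  rw [hC.isNowhereDense_iff, Set.eq_empty_iff_forall_notMem]
  intro x hx
  have hxC : x ∈ {x : N | (x : V) ∈ C} := interior_subset hx
  rw [mem_interior_iff_mem_nhds, nhds_subtype_eq_comap, Filter.mem_comap] at hx
  obtain ⟨U, hU, hUC⟩ := hx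
  have h1 : ∀ᶠ t in 𝓝[>] (0 : ℝ), γ x t ∈ U := hlim x x.2 hxC hU
  have h2 : ∀ᶠ t in 𝓝[>] (0 : ℝ), t ∈ Set.Ioc (0 : ℝ) 1 := Ioc_mem_nhdsGT one_pos
  obtain ⟨t, ht, ht'⟩ := (h1.and h2).exists
  obtain ⟨h3, h4⟩ := hγ x x.2 hxC t ht'
  exact h4 (hUC (show (⟨γ x t, h3⟩ : N) ∈ _ from ht))

/-! ### Bounded additive maps and unital positive maps -/

lemma norm_map_sub_le {V B : Type*} [AddCommGroup V] [Module ℂ V] [CStarAlgebra B]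
    (f : V →ₗ[ℂ] B) (a b : V) : ‖f (a - b)‖ ≤ ‖f a‖ + ‖f b‖ := by
  rw [map_sub]
  exact norm_sub_le _ _

/-- The kernel of a bounded additive map is closed. -/
lemma isClosed_setOf_map_eq_zero {V W : Type*} [SeminormedAddCommGroup V] [NormedAddCommGroup W]
    (T : V →+ W) {C : ℝ} (h : ∀ v, ‖T v‖ ≤ C * ‖v‖) : IsClosed {v | T v = 0} :=
  isClosed_singleton.preimage (AddMonoidHomClass.continuous_of_bound T C h)

/-- With `r = ‖f a‖`, positivity applied to `r ± a` gives `-r ≤ f (Φ a) ≤ r`. The crude factor 3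
comes from bounding the positive element `r + f (Φ a)` by `2r` and subtracting `r`; any constant
would do. -/
lemma norm_map_le_of_unital_positive_of_isSelfAdjoint {V B : Type*} [AddCommGroup V] [Module ℂ V]
    [StarAddMonoid V] [One V] [CStarAlgebra B] [PartialOrder B] [StarOrderedRing B]
    (f : V →ₗ[ℂ] B) (hstar : ∀ a, f (star a) = star (f a)) (hone : f 1 = 1)
    (Φ : V →ₗ[ℂ] V) (hΦ : Φ 1 = 1) (hpos : ∀ b, 0 ≤ f b → 0 ≤ f (Φ b))
    {a : V} (ha : IsSelfAdjoint a) :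
    ‖f (Φ a)‖ ≤ 3 * ‖f a‖ := by
  set r : ℝ := ‖f a‖ with hr
  have hsa : IsSelfAdjoint (f a) := by
    rw [IsSelfAdjoint, ← hstar, ha.star_eq]
  have h1 : f ((r : ℂ) • (1 : V)) = algebraMap ℝ B r := by
    rw [map_smul, hone, Algebra.algebraMap_eq_smul_one, Complex.coe_smul]
  have h2 := hpos ((r : ℂ) • 1 - a) (by
    rw [map_sub, h1, sub_nonneg]; exact hsa.le_algebraMap_norm_self)
  have h3 := hpos ((r : ℂ) • 1 + a) (by
    rw [map_add, h1, ← neg_le_iff_add_nonneg']; exact hsa.neg_algebraMap_norm_le_self)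
  rw [map_sub, map_smul, hΦ, map_sub, h1, sub_nonneg] at h2
  rw [map_add, map_smul, hΦ, map_add, h1] at h3
  have h5 := CStarAlgebra.norm_le_norm_of_nonneg_of_le h3 (add_le_add_right h2 (algebraMap ℝ B r))
  have h6 : ‖algebraMap ℝ B r‖ ≤ r := by
    -- In the zero algebra `‖1‖ = 0`, so this case is separate.
    rcases subsingleton_or_nontrivial B with h | h
    · rw [Subsingleton.elim (algebraMap ℝ B r) 0, norm_zero]
      exact norm_nonneg _
    · rw [norm_algebraMap', Real.norm_of_nonneg (norm_nonneg _)]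
  calc ‖f (Φ a)‖ = ‖(algebraMap ℝ B r + f (Φ a)) - algebraMap ℝ B r‖ := by
        rw [add_sub_cancel_left]
    _ ≤ ‖algebraMap ℝ B r + f (Φ a)‖ + ‖algebraMap ℝ B r‖ := norm_sub_le _ _
    _ ≤ (r + r) + r := add_le_add (h5.trans ((norm_add_le _ _).trans (add_le_add h6 h6))) h6
    _ = 3 * r := by ring

/-- Unital positive maps are bounded. The norm and the order of the domain are those that it
inherits from a C⋆-algebra. -/
lemma norm_map_le_of_unital_positive {V B : Type*} [AddCommGroup V] [Module ℂ V]
    [StarAddMonoid V] [StarModule ℂ V] [One V] [CStarAlgebra B] [PartialOrder B] [StarOrderedRing B]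
    (f : V →ₗ[ℂ] B) (hstar : ∀ a, f (star a) = star (f a)) (hone : f 1 = 1)
    (Φ : V →ₗ[ℂ] V) (hΦ : Φ 1 = 1) (hpos : ∀ b, 0 ≤ f b → 0 ≤ f (Φ b))
    (a : V) : ‖f (Φ a)‖ ≤ 6 * ‖f a‖ := by
  have hnorm : ‖f (star a)‖ = ‖f a‖ := by
    rw [hstar, norm_star]
  -- Both self-adjoint parts are left unhalved, with norm at most `2 ‖f a‖`. Each contributes `1/2 *
  -- 3 * 2 = 3` to the constant 6.
  have hdec : a = (1 / 2 : ℂ) • (a + star a)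
      + (-Complex.I / 2) • (Complex.I • (a - star a)) := by
    rw [smul_smul, show -Complex.I / 2 * Complex.I = 1 / 2 by
      rw [div_mul_eq_mul_div, neg_mul, Complex.I_mul_I, neg_neg], ← smul_add]
    rw [add_add_sub_cancel, ← two_smul ℂ a, smul_smul]
    norm_num
  have h1 := norm_map_le_of_unital_positive_of_isSelfAdjoint f hstar hone Φ hΦ hpos
    (a := a + star a) (by rw [IsSelfAdjoint, star_add, star_star, add_comm])
  have h2 := norm_map_le_of_unital_positive_of_isSelfAdjoint f hstar hone Φ hΦ hpos
    (a := Complex.I • (a - star a)) (by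
      rw [IsSelfAdjoint, star_smul, star_sub, star_star, Complex.star_def, Complex.conj_I,
        neg_smul, ← smul_neg, neg_sub])
  have h3 : ‖f (a + star a)‖ ≤ 2 * ‖f a‖ := by
    rw [map_add, two_mul]
    exact (norm_add_le _ _).trans_eq (by rw [hnorm])
  have h4 : ‖f (Complex.I • (a - star a))‖ ≤ 2 * ‖f a‖ := by
    rw [map_smul, norm_smul, Complex.norm_I, one_mul, map_sub, two_mul]
    exact (norm_sub_le _ _).trans_eq (by rw [hnorm])
  conv_lhs => rw [hdec, map_add, map_add, map_smul, map_smul, map_smul Φ (-Complex.I / 2),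
    map_smul f (-Complex.I / 2)]
  refine (norm_add_le _ _).trans ?_
  rw [norm_smul, norm_smul]
  have e1 : ‖(1 / 2 : ℂ)‖ = 1 / 2 := by norm_num
  have e2 : ‖(-Complex.I / 2 : ℂ)‖ = 1 / 2 := by simp
  rw [e1, e2]
  linarith

namespace VonNeumannAlgebra

variable {H : Type*} [NormedAddCommGroup H] [InnerProductSpace ℂ H] [CompleteSpace H]
variable {A : VonNeumannAlgebra H}

/-! ### Channels -/

/-- The element `a` as a matrix of size one. -/
def matOne (a : A.Elt) : Matrix (Fin 1) (Fin 1) A.Elt := Matrix.of fun _ _ => a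

/-- `A` inside the C⋆-algebra of matrices of size one over `B(H)`. -/
def toCStarMatrixOne : A.Elt →ₗ[ℂ] CStarMatrix (Fin 1) (Fin 1) (H →L[ℂ] H) where
  toFun a := A.toCStarMatrix (matOne a)
  map_add' _ _ := rfl
  map_smul' _ _ := rfl

lemma toCStarMatrixOne_eq_zero_iff {a : A.Elt} : toCStarMatrixOne a = 0 ↔ a = 0 :=
  ⟨fun h => Subtype.ext (congrFun (congrFun h 0) 0), fun h => by subst h; rfl⟩

lemma toCStarMatrixOne_star (a : A.Elt) :
    toCStarMatrixOne (star a) = star (toCStarMatrixOne a) := by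
  ext i j; rfl

lemma toCStarMatrixOne_one : toCStarMatrixOne (1 : A.Elt) = 1 := by
  ext i j : 2
  rw [Subsingleton.elim i j, CStarMatrix.one_apply_eq]
  rfl

/-- Channels are bounded. -/
lemma IsChannel.norm_le {Φ : A.Elt →ₗ[ℂ] A.Elt} (hΦ : A.IsChannel Φ) (a : A.Elt) :
    ‖toCStarMatrixOne (Φ a)‖ ≤ 6 * ‖toCStarMatrixOne a‖ :=
  norm_map_le_of_unital_positive toCStarMatrixOne toCStarMatrixOne_star toCStarMatrixOne_one Φ
    hΦ.1 (fun b hb => hΦ.2 1 (matOne b) hb) a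

/-- The map is `(1 - t) Φ + t Ψ`, and positive matrices of each size form a convex cone. -/
lemma IsChannel.segment {Φ Ψ : A.Elt →ₗ[ℂ] A.Elt} (hΦ : A.IsChannel Φ) (hΨ : A.IsChannel Ψ)
    {t : ℝ} (ht : t ∈ Set.Icc (0 : ℝ) 1) : A.IsChannel (Φ + (t : ℂ) • (Ψ - Φ)) := by
  refine ⟨by simp [hΦ.1, hΨ.1], fun n x hx => ?_⟩
  have h : x.map ⇑(Φ + (t : ℂ) • (Ψ - Φ))
      = ((1 - t : ℝ) : ℂ) • x.map Φ + (t : ℂ) • x.map Ψ := by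
    ext i j : 2
    simp only [Matrix.map_apply, Matrix.add_apply, Matrix.smul_apply, LinearMap.add_apply,
      LinearMap.smul_apply, LinearMap.sub_apply]
    push_cast
    module
  rw [h, toCStarMatrix_add, toCStarMatrix_smul, toCStarMatrix_smul, Complex.coe_smul,
    Complex.coe_smul]
  exact add_nonneg (smul_nonneg (sub_nonneg.2 ht.2) (hΦ.2 n x hx))
    (smul_nonneg ht.1 (hΨ.2 n x hx))

/-- Conjugation by an element of `A`. -/
def conjMap (u : A.Elt) : A.Elt →ₗ[ℂ] A.Elt where
  toFun a := u * a * star u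
  map_add' a b := by rw [mul_add, add_mul]
  map_smul' c a := by rw [mul_smul_comm, smul_mul_assoc, RingHom.id_apply]

/-- On matrices the conjugation becomes `x ↦ D x D*` with `D` the diagonal matrix of `u`, which
preserves positivity. -/
lemma isChannel_conjMap {u : A.Elt} (hu : u * star u = 1) : A.IsChannel (conjMap u) := by
  refine ⟨by simp [conjMap, hu], fun n x hx => ?_⟩
  set D : CStarMatrix (Fin n) (Fin n) (H →L[ℂ] H) :=
    CStarMatrix.ofMatrix (Matrix.diagonal fun _ => (u : H →L[ℂ] H)) with hD
  have : A.toCStarMatrix (x.map (conjMap u)) = D * A.toCStarMatrix x * star D := by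
    have hs : star D = CStarMatrix.ofMatrix (Matrix.diagonal fun _ => star (u : H →L[ℂ] H)) := by
      change (Matrix.diagonal fun _ => (u : H →L[ℂ] H)).conjTranspose = _
      rw [Matrix.diagonal_conjTranspose]; rfl
    rw [hs]
    have key : (x.map (conjMap u)).map (fun a => (a : H →L[ℂ] H))
        = Matrix.diagonal (fun _ => (u : H →L[ℂ] H)) * x.map (fun a => (a : H →L[ℂ] H))
          * Matrix.diagonal fun _ => star (u : H →L[ℂ] H) := by
      ext i j : 1
      rw [Matrix.mul_diagonal, Matrix.diagonal_mul]
      rfl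
    exact congrArg CStarMatrix.ofMatrix key
  rw [this]
  exact star_right_conjugate_nonneg hx D

/-! ### States -/

/-- The vector functional `a ↦ ⟨ξ, a η⟩`. -/
def vectorFunctional (A : VonNeumannAlgebra H) (ξ η : H) : A.Elt →ₗ[ℂ] ℂ where
  toFun a := ⟪ξ, (a : H →L[ℂ] H) η⟫_ℂ
  map_add' a b := by simp
  map_smul' c a := by simp

lemma isState_vectorFunctional {ξ : H} (hξ : ‖ξ‖ = 1) :
    A.IsState (A.vectorFunctional ξ ξ) := by
  refine ⟨fun a => ⟨‖(a : H →L[ℂ] H) ξ‖ ^ 2, by positivity, ?_⟩, ?_⟩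
  · change ⟪ξ, (star (a : H →L[ℂ] H) * (a : H →L[ℂ] H)) ξ⟫_ℂ = _
    rw [ContinuousLinearMap.star_eq_adjoint, mul_apply_eq_comp,
      ContinuousLinearMap.adjoint_inner_right, inner_self_eq_norm_sq_to_K]
    norm_cast
  · change ⟪ξ, (1 : H →L[ℂ] H) ξ⟫_ℂ = 1
    rw [one_apply_eq_self, inner_self_eq_norm_sq_to_K, hξ]
    simp

/-- States separate the points of `A`. -/
lemma eq_zero_of_forall_isState {a : A.Elt} (h : ∀ ρ, A.IsState ρ → ρ a = 0) : a = 0 := by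
  have key : ∀ ξ : H, ⟪ξ, (a : H →L[ℂ] H) ξ⟫_ℂ = 0 := by
    intro ξ
    by_cases hξ : ξ = 0
    · simp [hξ]
    · have h1 := h _ (isState_vectorFunctional (A := A) (ξ := ((‖ξ‖⁻¹ : ℝ) : ℂ) • ξ) (by
        rw [norm_smul, Complex.norm_real, norm_inv, norm_norm,
          inv_mul_cancel₀ (norm_ne_zero_iff.2 hξ)]))
      change ⟪((‖ξ‖⁻¹ : ℝ) : ℂ) • ξ, (a : H →L[ℂ] H) (((‖ξ‖⁻¹ : ℝ) : ℂ) • ξ)⟫_ℂ = 0 at h1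
      simpa [inner_smul_left, inner_smul_right, hξ] using h1
  refine Subtype.ext (ContinuousLinearMap.coe_injective ?_)
  -- Over `ℂ`, polarization shows that an operator with vanishing quadratic form is zero.
  refine (inner_map_self_eq_zero (T := ((a : H →L[ℂ] H) : H →ₗ[ℂ] H))).1 fun ξ => ?_
  rw [← inner_conj_symm]
  exact (congrArg _ (key ξ)).trans (map_zero _)

/-! ### Weak⋆ topology -/

/-- Sequences concentrated at index 0 reduce the series defining the σ-weak topology to a single
term. -/
lemma vectorFunctional_mem_predual (ξ η : H) : A.vectorFunctional ξ η ∈ A.Predual := by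
  have hsum : ∀ v : H, Summable fun n => ‖(Pi.single 0 v : ℕ → H) n‖ ^ 2 := by
    refine fun v => summable_of_ne_finset_zero (s := {0}) fun n hn => ?_
    rw [Pi.single_eq_of_ne (by simpa using hn)]; simp
  have h : Continuous[A.sigmaWeak, inferInstance] fun a : A.Elt =>
      ∑' n, ⟪(Pi.single 0 ξ : ℕ → H) n, (a : H →L[ℂ] H) ((Pi.single 0 η : ℕ → H) n)⟫_ℂ :=
    continuous_iff_le_induced.2
      (iInf_le_of_le ⟨(Pi.single 0 ξ, Pi.single 0 η), hsum ξ, hsum η⟩ le_rfl)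
  refine (congrArg _ (funext fun a => ?_)).mp h
  rw [tsum_eq_single 0 fun n hn => by rw [Pi.single_eq_of_ne hn, inner_zero_left],
    Pi.single_eq_same, Pi.single_eq_same]
  rfl

lemma projNorm_zero_le : A.projNorm 0 ≤ 0 := by
  -- The empty decomposition `p = q = 0` represents 0 at cost 0.
  refine csInf_le ⟨0, ?_⟩ ⟨0, 0, 0, 0, 0, 0, by simp, by simp⟩
  rintro t ⟨p, q, a, b, v, w, -, rfl⟩
  have : 0 ≤ A.predualMatNorm w := Real.sInf_nonneg fun _ h => h.1
  have := matNorm_nonneg v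
  positivity

/-- A constant sequence is Cauchy, its differences having projective norm at most 0. -/
lemma isPredualFunctional_pairing (u : A.Elt ⊗[ℂ] A.Predual) :
    A.IsPredualFunctional fun Ψ => A.pairing Ψ.1 u := by
  refine ⟨fun _ => u, fun ε hε => ⟨0, fun m _ n _ => ?_⟩, fun Ψ => tendsto_const_nhds⟩
  rw [sub_self]
  exact projNorm_zero_le.trans_lt hε

lemma continuous_weakStar_vectorFunctional (a : A.Elt) (ξ η : H) :
    Continuous[A.weakStarTopology, inferInstance]
      fun Ψ : A.SigmaCB => ⟪ξ, (Ψ.1 a : H →L[ℂ] H) η⟫_ℂ := by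
  have h : A.IsPredualFunctional fun Ψ => ⟪ξ, (Ψ.1 a : H →L[ℂ] H) η⟫_ℂ :=
    isPredualFunctional_pairing
      (a ⊗ₜ[ℂ] (⟨A.vectorFunctional ξ η, vectorFunctional_mem_predual ξ η⟩ : A.Predual))
  exact continuous_iff_le_induced.2 (iInf_le_of_le ⟨_, h⟩ le_rfl)

/-- Pairings are linear in the map, and a pointwise limit of them inherits affine identities. -/
lemma IsPredualFunctional.map_segment {f : A.SigmaCB → ℂ} (hf : A.IsPredualFunctional f)
    (Φ Ψ : A.SigmaCB) (c : ℂ) : f (Φ + c • (Ψ - Φ)) = f Φ + c * (f Ψ - f Φ) := by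
  obtain ⟨u, -, hu⟩ := hf
  refine tendsto_nhds_unique (hu _) ?_
  refine ((hu Φ).add (((hu Ψ).sub (hu Φ)).const_mul c)).congr fun n => ?_
  have : A.pairing (Φ + c • (Ψ - Φ)).1 = A.pairing Φ.1 + c • (A.pairing Ψ.1 - A.pairing Φ.1) := by
    refine TensorProduct.ext' fun a φ => ?_
    simp [pairing]
  rw [this]; simp

/-- Along the segment every predual functional is affine in `t`, so no norm estimate is needed. -/
lemma tendsto_weakStar_segment (Φ Ψ : A.SigmaCB) :
    Filter.Tendsto (fun t : ℝ => Φ + (t : ℂ) • (Ψ - Φ)) (𝓝[>] 0)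
      (@nhds _ A.weakStarTopology Φ) := by
  rw [nhds_iInf, Filter.tendsto_iInf]
  intro f
  rw [nhds_induced, Filter.tendsto_comap_iff]
  have : Continuous fun t : ℝ => f.1 Φ + (t : ℂ) * (f.1 Ψ - f.1 Φ) := by fun_prop
  have h := (this.tendsto 0).mono_left (nhdsWithin_le_nhds (s := Set.Ioi 0))
  rw [Complex.ofReal_zero, zero_mul, add_zero] at h
  exact h.congr fun t => (f.2.map_segment Φ Ψ t).symm

lemma tendsto_norm_segment (Φ Ψ : A.SigmaCB) :
    Filter.Tendsto (fun t : ℝ => Φ + (t : ℂ) • (Ψ - Φ)) (𝓝[>] 0) (𝓝 Φ) := by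
  rw [tendsto_iff_norm_sub_tendsto_zero]
  have h : Filter.Tendsto (fun t : ℝ => ‖(t : ℂ)‖ * A.cbNorm (Ψ - Φ).1) (𝓝[>] 0) (𝓝 0) := by
    have : Continuous fun t : ℝ => ‖(t : ℂ)‖ * A.cbNorm (Ψ - Φ).1 := by fun_prop
    simpa using (this.tendsto 0).mono_left (nhdsWithin_le_nhds (s := Set.Ioi 0))
  refine squeeze_zero (fun _ => norm_nonneg _) (fun t => ?_) h
  rw [add_sub_cancel_left]
  exact cbNorm_le ((cbBound_cbNorm (Ψ - Φ).2.1).smul t)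

/-- For a channel `Θ`, the condition `Θ (Φ a) = Φ a` on `Φ` is closed in the CB-norm. -/
lemma isClosed_setOf_apply_eq {Θ : A.Elt →ₗ[ℂ] A.Elt} (hΘ : A.IsChannel Θ) (a : A.Elt) :
    IsClosed {Φ : A.SigmaCB | Θ (Φ.1 a) = Φ.1 a} := by
  let T : A.SigmaCB →+ CStarMatrix (Fin 1) (Fin 1) (H →L[ℂ] H) :=
    AddMonoidHom.mk' (fun Φ => toCStarMatrixOne (Θ (Φ.1 a) - Φ.1 a)) fun Φ Ψ => by
      rw [← map_add]
      congr 1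
      change Θ (Φ.1 a + Ψ.1 a) - (Φ.1 a + Ψ.1 a) = _
      rw [map_add]
      abel
  -- Here `7 = 6 + 1`, from the bound for `Θ` and the one for the identity.
  have hT : ∀ Φ, ‖T Φ‖ ≤ (7 * ‖toCStarMatrixOne a‖) * ‖Φ‖ := fun Φ => by
    have h1 : ‖toCStarMatrixOne (Φ.1 a)‖ ≤ A.cbNorm Φ.1 * ‖toCStarMatrixOne a‖ :=
      (cbBound_cbNorm Φ.2.1).2 1 (matOne a)
    have h2 := hΘ.norm_le (Φ.1 a)
    have h3 := norm_map_sub_le (toCStarMatrixOne (A := A)) (Θ (Φ.1 a)) (Φ.1 a)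
    have h4 : ‖toCStarMatrixOne (Θ (Φ.1 a) - Φ.1 a)‖
        ≤ (7 * ‖toCStarMatrixOne a‖) * A.cbNorm Φ.1 := by
      refine h3.trans ?_
      linarith
    exact h4
  have hker : ∀ Φ, T Φ = 0 ↔ Θ (Φ.1 a) = Φ.1 a := fun Φ =>
    toCStarMatrixOne_eq_zero_iff.trans sub_eq_zero
  simpa only [hker] using isClosed_setOf_map_eq_zero T hT

/-- For a bounded operator `y`, the condition that `Φ a` commutes with `y` is weak⋆ closed. -/
lemma isClosed_weakStar_setOf_commute (y : H →L[ℂ] H) (a : A.Elt) :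
    IsClosed[A.weakStarTopology]
      {Φ : A.SigmaCB | (Φ.1 a : H →L[ℂ] H) * y = y * (Φ.1 a : H →L[ℂ] H)} := by
  let _ := A.weakStarTopology
  -- Moving `y` to the other side by its adjoint turns both products into matrix coefficients of `Φ
  -- a` at fixed vectors.
  have : {Φ : A.SigmaCB | (Φ.1 a : H →L[ℂ] H) * y = y * (Φ.1 a : H →L[ℂ] H)}
      = ⋂ ξ : H, ⋂ η : H, {Φ | ⟪ξ, (Φ.1 a : H →L[ℂ] H) (y η)⟫_ℂ
          = ⟪star y ξ, (Φ.1 a : H →L[ℂ] H) η⟫_ℂ} := by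
    ext Φ
    simp only [Set.mem_ofPred_eq, Set.mem_iInter, ContinuousLinearMap.star_eq_adjoint,
      ContinuousLinearMap.adjoint_inner_left]
    constructor
    · intro h ξ η
      exact congrArg _ (congrArg (fun T : H →L[ℂ] H => T η) h)
    · intro h
      ext η
      exact ext_inner_left ℂ fun ξ => h ξ η
  rw [this]
  exact isClosed_iInter fun ξ => isClosed_iInter fun η => isClosed_eq
    (continuous_weakStar_vectorFunctional a ξ (y η))
    (continuous_weakStar_vectorFunctional a (star y ξ) η)

end VonNeumannAlgebra

/-! ### Unitaries and commutants -/

/-- An operator that commutes with the unitaries of a norm closed star subalgebra commutes with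
the subalgebra. -/
lemma StarSubalgebra.commute_of_forall_unitary {B : Type*} [CStarAlgebra B]
    (S : StarSubalgebra ℂ B) (hS : IsClosed (S : Set B)) {x : B}
    (h : ∀ u ∈ S, u ∈ unitary B → x * u = u * x) {y : B} (hy : y ∈ S) : x * y = y * x := by
  -- Closedness makes `S` a C⋆-algebra, hence the linear span of its unitaries.
  have : IsClosed (S : Set B) := hS
  have hmem : (⟨y, hy⟩ : S) ∈ Submodule.span ℂ (unitary S : Set S) := by
    rw [CStarAlgebra.span_unitary]; trivial
  suffices H : ∀ z ∈ Submodule.span ℂ (unitary S : Set S), x * (z : B) = z * x from H _ hmem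
  intro z hz
  induction hz using Submodule.span_induction with
  | mem u hu =>
    refine h u u.2 ?_
    have h1 := congrArg (Subtype.val) (Unitary.star_mul_self_of_mem hu)
    have h2 := congrArg (Subtype.val) (Unitary.mul_star_self_of_mem hu)
    exact Unitary.mem_iff.2 ⟨h1, h2⟩
  | zero => simp
  | add u v _ _ hu hv => simp [mul_add, add_mul, hu, hv]
  | smul c u _ hu => simp [hu]

/-! ### Local and causal channels -/

namespace QFT

variable {d : ℕ} {M : Type*} [TopologicalSpace M]
  [ChartedSpace (EuclideanSpace ℝ (Fin d)) M] [IsManifold (𝓡 d) ∞ M]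
  {L : LorentzianSpacetime d M}
  {H : Type*} [NormedAddCommGroup H] [InnerProductSpace ℂ H] [CompleteSpace H]

lemma algOn_mono (𝔄 : QFT L H) {X Y : Set M} (h : X ⊆ Y) : 𝔄.algOn X ⊆ 𝔄.algOn Y :=
  Set.centralizer_subset (Set.centralizer_subset fun _ ⟨R, hR, ha⟩ => ⟨R, hR.trans h, ha⟩)

lemma star_mem_algOn (𝔄 : QFT L H) {X : Set M} {a : H →L[ℂ] H} (ha : a ∈ 𝔄.algOn X) :
    star a ∈ 𝔄.algOn X := by
  refine Set.star_mem_centralizer' (fun b hb => Set.star_mem_centralizer' ?_ hb) ha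
  exact fun c ⟨R, hR, hc⟩ => ⟨R, hR, star_mem hc⟩

variable [Nonempty M]

lemma Loc_segment {𝔄 : QFT L H} {K : Set M} {Φ Ψ : 𝔄.globalAlg.Elt →ₗ[ℂ] 𝔄.globalAlg.Elt}
    (hΦ : Φ ∈ 𝔄.Loc K) (hΨ : Ψ ∈ 𝔄.Loc K) {t : ℝ} (ht : t ∈ Set.Icc (0 : ℝ) 1) :
    Φ + (t : ℂ) • (Ψ - Φ) ∈ 𝔄.Loc K :=
  ⟨hΦ.1.segment hΨ.1 ht, fun a ha => by simp [hΦ.2 a ha, hΨ.2 a ha]⟩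

/-- Vector states already separate points, so the quantifier over states becomes an operator
equation. -/
lemma mem_Cau_iff {𝔄 : QFT L H} {K : Set M} {Φ : 𝔄.globalAlg.Elt →ₗ[ℂ] 𝔄.globalAlg.Elt} :
    Φ ∈ 𝔄.Cau K ↔ Φ ∈ 𝔄.Loc K ∧
      ∀ S R : Set M, IsCompact S → IsCompact R → S ⊆ L.inRegion K → R ⊆ L.outRegion K →
        L.SpacelikeSeparated S R → ∀ ΦS ∈ 𝔄.Loc S,
        ∀ O : 𝔄.globalAlg.Elt, (O : H →L[ℂ] H) ∈ 𝔄.algOn R → ΦS (Φ O) = Φ O := by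
  refine and_congr_right fun _ => ⟨fun h S R hS hR hSK hRK hSR ΦS hΦS O hO => ?_,
    fun h ρ _ S R hS hR hSK hRK hSR ΦS hΦS O hO => ?_⟩
  · exact sub_eq_zero.1 (VonNeumannAlgebra.eq_zero_of_forall_isState fun ρ hρ =>
      h ρ hρ S R hS hR hSK hRK hSR ΦS hΦS O hO)
  · rw [h S R hS hR hSK hRK hSR ΦS hΦS O hO, sub_self, map_zero]

/-- Moving from a causal channel towards an acausal one, one immediately leaves the causal
channels. -/
lemma Cau_segment {𝔄 : QFT L H} {K : Set M} {Φ Ψ : 𝔄.globalAlg.Elt →ₗ[ℂ] 𝔄.globalAlg.Elt}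
    (hΦ : Φ ∈ 𝔄.Cau K) (hΨ : Ψ ∈ 𝔄.Loc K) (hΨ' : Ψ ∉ 𝔄.Cau K) {t : ℝ} (ht : t ≠ 0) :
    Φ + (t : ℂ) • (Ψ - Φ) ∉ 𝔄.Cau K := by
  refine fun h => hΨ' (mem_Cau_iff.2 ⟨hΨ, fun S R hS hR hSK hRK hSR ΦS hΦS O hO => ?_⟩)
  have h1 := (mem_Cau_iff.1 h).2 S R hS hR hSK hRK hSR ΦS hΦS O hO
  have h2 := (mem_Cau_iff.1 hΦ).2 S R hS hR hSK hRK hSR ΦS hΦS O hO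
  simp only [LinearMap.add_apply, LinearMap.smul_apply, LinearMap.sub_apply, map_add, map_smul,
    map_sub, h2] at h1
  -- What remains is `Φ O + t (ΦS (Ψ O) - Φ O) = Φ O + t (Ψ O - Φ O)`; cancel `Φ O`, then `t`, then
  -- `Φ O` again.
  exact sub_left_injective
    (smul_right_injective _ (Complex.ofReal_ne_zero.2 ht) (add_left_cancel h1))

lemma isClosed_nCau (𝔄 : QFT L H) (K : Set M) :
    IsClosed {Φ : 𝔄.nLoc K | (Φ : 𝔄.globalAlg.SigmaCB) ∈ 𝔄.nCau K} := by
  have : {Φ : 𝔄.nLoc K | (Φ : 𝔄.globalAlg.SigmaCB) ∈ 𝔄.nCau K} =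
      Subtype.val ⁻¹' {Φ : 𝔄.globalAlg.SigmaCB | ∀ S R : Set M, IsCompact S → IsCompact R →
        S ⊆ L.inRegion K → R ⊆ L.outRegion K → L.SpacelikeSeparated S R → ∀ ΦS ∈ 𝔄.Loc S,
        ∀ O : 𝔄.globalAlg.Elt, (O : H →L[ℂ] H) ∈ 𝔄.algOn R → ΦS (Φ.1 O) = Φ.1 O} := by
    ext Φ
    exact mem_Cau_iff.trans (and_iff_right Φ.2)
  rw [this]
  refine IsClosed.preimage continuous_subtype_val ?_
  simp only [Set.ofPred_forall]
  -- The seven are `S`, `R` and the five conditions on them.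
  iterate 7 refine isClosed_iInter fun _ => ?_
  refine isClosed_iInter fun ΦS => isClosed_iInter fun hΦS => isClosed_iInter fun O =>
    isClosed_iInter fun _ => ?_
  exact VonNeumannAlgebra.isClosed_setOf_apply_eq hΦS.1 O

/-- A fixed point of all channels local to `S` commutes with the relative commutant of
`𝔄(S^⊥)`. -/
lemma commute_of_forall_Loc {𝔄 : QFT L H} {S : Set M} {x : 𝔄.globalAlg.Elt}
    (hx : ∀ ΦS ∈ 𝔄.Loc S, ΦS x = x) {y : H →L[ℂ] H} (hy : y ∈ 𝔄.globalAlg)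
    (hy' : y ∈ Set.centralizer (𝔄.algOn (L.spacelikeCompl S))) :
    (x : H →L[ℂ] H) * y = y * x := by
  let N : StarSubalgebra ℂ (H →L[ℂ] H) :=
    𝔄.globalAlg.toStarSubalgebra ⊓ StarSubalgebra.centralizer ℂ (𝔄.algOn (L.spacelikeCompl S))
  have hN : IsClosed (N : Set (H →L[ℂ] H)) := by
    refine IsClosed.inter ?_ (Set.isClosed_centralizer _)
    change IsClosed (𝔄.globalAlg : Set (H →L[ℂ] H))
    rw [← VonNeumannAlgebra.centralizer_centralizer]
    exact Set.isClosed_centralizer _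
  refine N.commute_of_forall_unitary hN (fun u hu hu' => ?_) ⟨hy, ?_⟩
  · have huu := Unitary.mul_star_self_of_mem hu'
    -- Conjugation by `u` fixes `𝔄(S^⊥)`, so it is local to `S`; that it fixes `x` means `u x = x
    -- u`.
    have hloc := hx (VonNeumannAlgebra.conjMap ⟨u, hu.1⟩)
      ⟨VonNeumannAlgebra.isChannel_conjMap (Subtype.ext huu), fun a ha => Subtype.ext ?_⟩
    · have h1 : u * (x : H →L[ℂ] H) * star u = x := congrArg Subtype.val hloc
      rw [← congrArg (· * u) h1]
      simp only [mul_assoc, Unitary.star_mul_self_of_mem hu', mul_one]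
    · change u * (a : H →L[ℂ] H) * star u = a
      rw [← ((StarSubalgebra.mem_centralizer_iff ℂ).1 hu.2 a ha).1, mul_assoc, huu, mul_one]
  · exact (StarSubalgebra.mem_centralizer_iff ℂ).2 fun g hg =>
      ⟨hy' g hg, hy' _ (𝔄.star_mem_algOn hg)⟩

/-- If the algebras `𝔄(S^⊥)` are their own relative bicommutants, then causality of `Φ` says that
`Φ O` commutes with the relative commutant of `𝔄(S^⊥)`. -/
lemma mem_Cau_iff_commute {𝔄 : QFT L H} (h𝔄 : 𝔄.RelativeBicommutant) {K : Set M}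
    {Φ : 𝔄.globalAlg.Elt →ₗ[ℂ] 𝔄.globalAlg.Elt} :
    Φ ∈ 𝔄.Cau K ↔ Φ ∈ 𝔄.Loc K ∧
      ∀ S R : Set M, IsCompact S → IsCompact R → S ⊆ L.inRegion K → R ⊆ L.outRegion K →
        L.SpacelikeSeparated S R →
        ∀ O : 𝔄.globalAlg.Elt, (O : H →L[ℂ] H) ∈ 𝔄.algOn R →
        ∀ y ∈ 𝔄.globalAlg, y ∈ Set.centralizer (𝔄.algOn (L.spacelikeCompl S)) →
          (Φ O : H →L[ℂ] H) * y = y * (Φ O : H →L[ℂ] H) := by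
  rw [mem_Cau_iff]
  refine and_congr_right fun hΦ => ⟨fun h S R hS hR hSK hRK hSR O hO y hy hy' => ?_,
    fun h S R hS hR hSK hRK hSR ΦS hΦS O hO => ?_⟩
  · exact commute_of_forall_Loc
      (fun ΦS hΦS => h S R hS hR hSK hRK hSR ΦS hΦS O hO) hy hy'
  -- The bicommutant hypothesis needs `S^⊥` nonempty, which a point of `R` ensures. If `R` is empty,
  -- `O` lies in every `𝔄(X)`, so locality alone makes both channels fix it.
  · rcases R.eq_empty_or_nonempty with rfl | ⟨r, hr⟩
    · have hmem : ∀ X : Set M, (O : H →L[ℂ] H) ∈ 𝔄.algOn X :=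
        fun X => 𝔄.algOn_mono (Set.empty_subset X) hO
      rw [hΦ.2 O (hmem _), hΦS.2 O (hmem _)]
    · have hne : (L.spacelikeCompl S).Nonempty :=
        ⟨r, fun s hs r' hr' => by rw [Set.mem_singleton_iff.1 hr']; exact hSR s hs r hr⟩
      exact hΦS.2 _ (h𝔄 S hS hne _ (Φ O).2 (h S R hS hR hSK hRK hSR O hO))

/-- The commutation criterion is used because `Φ ↦ ΦS (Φ O)` need not be weak⋆ continuous. -/
lemma isClosed_weakStar_nCau {𝔄 : QFT L H} (h𝔄 : 𝔄.RelativeBicommutant) (K : Set M) :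
    IsClosed[TopologicalSpace.induced Subtype.val 𝔄.globalAlg.weakStarTopology]
      {Φ : 𝔄.nLoc K | (Φ : 𝔄.globalAlg.SigmaCB) ∈ 𝔄.nCau K} := by
  let _ := 𝔄.globalAlg.weakStarTopology
  have : {Φ : 𝔄.nLoc K | (Φ : 𝔄.globalAlg.SigmaCB) ∈ 𝔄.nCau K} =
      Subtype.val ⁻¹' {Φ : 𝔄.globalAlg.SigmaCB | ∀ S R : Set M, IsCompact S → IsCompact R →
        S ⊆ L.inRegion K → R ⊆ L.outRegion K → L.SpacelikeSeparated S R →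
        ∀ O : 𝔄.globalAlg.Elt, (O : H →L[ℂ] H) ∈ 𝔄.algOn R →
        ∀ y ∈ 𝔄.globalAlg, y ∈ Set.centralizer (𝔄.algOn (L.spacelikeCompl S)) →
          (Φ.1 O : H →L[ℂ] H) * y = y * (Φ.1 O : H →L[ℂ] H)} := by
    ext Φ
    exact (mem_Cau_iff_commute h𝔄).trans (and_iff_right Φ.2)
  rw [this]
  refine IsClosed.preimage continuous_induced_dom ?_
  simp only [Set.ofPred_forall]
  iterate 7 refine isClosed_iInter fun _ => ?_
  refine isClosed_iInter fun O => isClosed_iInter fun _ => isClosed_iInter fun y =>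
    isClosed_iInter fun _ => isClosed_iInter fun _ => ?_
  exact VonNeumannAlgebra.isClosed_weakStar_setOf_commute y O

end QFT

end

theorem theorem1 {d : ℕ} {M : Type*} [TopologicalSpace M] [T2Space M] [SecondCountableTopology M]
    [Nonempty M] [ChartedSpace (EuclideanSpace ℝ (Fin d)) M] [IsManifold (𝓡 d) ∞ M]
    (L : LorentzianSpacetime d M) (hL : L.GloballyHyperbolic)
    {H : Type*} [NormedAddCommGroup H] [InnerProductSpace ℂ H] [CompleteSpace H]
    (𝔄 : QFT L H) (hσ : 𝔄.SigmaFinite)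
    (K : Set M) (hK : IsCompact K)
    (hac : ∃ Φ ∈ 𝔄.nLoc K, Φ ∉ 𝔄.nCau K) :
    IsNowhereDense {Φ : 𝔄.nLoc K | (Φ : 𝔄.globalAlg.SigmaCB) ∈ 𝔄.nCau K} ∧
    (𝔄.RelativeBicommutant →
      @IsNowhereDense (𝔄.nLoc K)
        (TopologicalSpace.induced Subtype.val 𝔄.globalAlg.weakStarTopology)
        {Φ : 𝔄.nLoc K | (Φ : 𝔄.globalAlg.SigmaCB) ∈ 𝔄.nCau K}) := by
  obtain ⟨Ψ, hΨ, hΨ'⟩ := hac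
  let γ (Φ : 𝔄.globalAlg.SigmaCB) (t : ℝ) : 𝔄.globalAlg.SigmaCB := Φ + (t : ℂ) • (Ψ - Φ)
  have hγ : ∀ Φ ∈ 𝔄.nLoc K, Φ ∈ 𝔄.nCau K → ∀ t ∈ Set.Ioc (0 : ℝ) 1,
      γ Φ t ∈ 𝔄.nLoc K ∧ γ Φ t ∉ 𝔄.nCau K := fun Φ hΦ hΦ' t ht =>
    ⟨QFT.Loc_segment hΦ hΨ ⟨ht.1.le, ht.2⟩, QFT.Cau_segment hΦ' hΨ hΨ' ht.1.ne'⟩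
  refine ⟨isNowhereDense_preimage_val_of_path (𝔄.isClosed_nCau K) γ hγ fun Φ _ _ =>
    VonNeumannAlgebra.tendsto_norm_segment Φ Ψ, fun h𝔄 => ?_⟩
  -- This shadows the CB-norm topology; the same segments are used again.
  let _ := 𝔄.globalAlg.weakStarTopology
  exact isNowhereDense_preimage_val_of_path (QFT.isClosed_weakStar_nCau h𝔄 K) γ hγ fun Φ _ _ =>
    VonNeumannAlgebra.tendsto_weakStar_segment Φ Ψ
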